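/- Let $X\in\mathbb R^{n\times p}$ be a fixed matrix and let $\{1,\dots,p\}=\bigcup_{j=1}^m G_j$ be a partition into pairwise disjoint groups; put $k_j=|G_j|$, and let $X_{G_j}$ be the $n\times k_j$ matrix formed by the columns of $X$ with index in $G_j$. Let $\epsilon=(\epsilon_1,\dots,\epsilon_n)$ be a random vector with independent coordinates such that $\epsilon_i-\mathbb E\epsilon_i\sim N(0,\sigma_i^2)$, where $0\le\sigma_i\le\sigma$ for every $i=1,\dots,n$, with $\sigma\ge 0$ (a degenerate $N(0,0)$ is allowed). Then the group noise condition holds with $a=\sigma\ge 0$ and $b=\sqrt2\,\sigma\ge 0$, that is: for every fixed $j\in\{1,\dots,m\}$ and every $\eta\in(0,1)$, with probability strictly larger than $1-\eta$, $$\bigl\|(X_{G_j}^\top X_{G_j})^{-1/2}X_{G_j}^\top(\epsilon-\mathbb E\epsilon)\bigr\|_2\le \sigma\sqrt{k_j}+\sqrt2\,\sigma\sqrt{-\ln\eta}.$$ Here $\|\cdot\|_2$ is the Euclidean norm, and $(X_{G_j}^\top X_{G_j})^{-1/2}$ is the inverse of the positive semidefinite square root; if $X_{G_j}^\top X_{G_j}$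 is singular, it is understood as the Moore–Penrose inverse of that square root. -/

import Mathlib

open MeasureTheory ProbabilityTheory
open scoped NNReal Matrix MatrixOrder

/-- `G 0, …, G (m-1)` are pairwise disjoint groups whose union is the set of all `p` variables. -/
structure IsGroupPartition {p m : ℕ} (G : Fin m → Finset (Fin p)) : Prop where
  disjoint : ∀ i j, i ≠ j → Disjoint (G i) (G j)
  cover : ∀ v, ∃ j, v ∈ G j

/-- The `n × |F|` matrix `X_F` made of the columns of `X` with index in `F`. -/
def colSubmatrix {n p : ℕ} (X : Matrix (Fin n) (Fin p) ℝ) (F : Finset (Fin p)) :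
    Matrix (Fin n) F ℝ :=
  X.submatrix id Subtype.val

/-- The vector `(X_Fᵀ X_F)^(-1/2) X_Fᵀ v`, with its Euclidean norm. The real power of the positive
semidefinite matrix `X_Fᵀ X_F` is the one of the continuous functional calculus: an eigenvalue
`t > 0` becomes `t ^ (-1/2)`. An eigenvalue `0`, possible only if the columns of `X_F` are linearly
dependent, stays `0`, so that in this case the power is the Moore-Penrose one. -/
noncomputable def groupProjection {n p : ℕ} (X : Matrix (Fin n) (Fin p) ℝ) (F : Finset (Fin p))
    (v : Fin n → ℝ) : EuclideanSpace ℝ F :=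
  WithLp.toLp 2
    ((((colSubmatrix X F)ᵀ * colSubmatrix X F) ^ (-(1 / 2) : ℝ) * (colSubmatrix X F)ᵀ) *ᵥ v)

/-- The group noise condition with constants `a` and `b`, for the noise vector `ε` on the
probability space `(Ω, μ)`, the design matrix `X` and the groups `G j`. -/
def GroupNoiseCondition {Ω : Type*} [MeasurableSpace Ω] (μ : Measure Ω) {n p m : ℕ}
    (X : Matrix (Fin n) (Fin p) ℝ) (G : Fin m → Finset (Fin p)) (ε : Fin n → Ω → ℝ)
    (a b : ℝ) : Prop :=
  0 ≤ a ∧ 0 ≤ b ∧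
    ∀ j : Fin m, ∀ η : ℝ, 0 < η → η < 1 →
      1 - η < μ.real {ω | ‖groupProjection X (G j) (fun i => ε i ω - ∫ ω', ε i ω' ∂μ)‖ ≤
        a * √((G j).card : ℝ) + b * √(-Real.log η)}

/-! Put `Y = X_{G_j}`, `k = k_j`, `A = (YᵀY)^(-1/2) Yᵀ`. Since `A Aᵀ` is an orthogonal projection,
`Aᵀ` is a contraction. Averaging `exp(τ h·Ax)` over a standard Gaussian `h` turns `exp(θ‖Ax‖²)` into
a linear exponential; swapping the integrals and using `‖Aᵀh‖ ≤ ‖h‖` gives the chi-squared bound `(1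
- 2θσ²)^(-k/2)` (`lintegral_exp_sum_sq_mulVec_le`), without rotating the noise, whose variances may
differ. Markov's inequality with the optimal `θ` and `1 + y < exp y` then give a tail strictly below
`exp(-c²/2)` beyond `σ(√k + c)` (`pi_gaussianReal_sqrt_sum_sq_mulVec_gt_lt`). Taking `c = √2 √(-log
η)` makes this `η`. -/

/-- For a positive semidefinite real matrix `M`, the matrix `M ^ (-1/2) * M * M ^ (-1/2)` is a
contraction (it is the orthogonal projection onto the range of `M`). -/
theorem Matrix.rpow_neg_half_conj_le_one {κ : Type*} [Fintype κ] [DecidableEq κ]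
    {M : Matrix κ κ ℝ} (hM : 0 ≤ M) :
    M ^ (-(1 / 2) : ℝ) * M * M ^ (-(1 / 2) : ℝ) ≤ 1 := by
  -- The power `-1/2` may be discontinuous at `0`; finiteness of the spectrum makes every function
  -- continuous on it.
  have hfin : (spectrum ℝ≥0 M).Finite := by
    rw [← spectrum.preimage_algebraMap (R := ℝ≥0) ℝ]
    exact (Matrix.finite_real_spectrum (A := M)).preimage NNReal.coe_injective.injOn
  have hcont (f : ℝ≥0 → ℝ≥0) : ContinuousOn f (spectrum ℝ≥0 M) := hfin.continuousOn f
  have key : M ^ (-(1 / 2) : ℝ) * M * M ^ (-(1 / 2) : ℝ) =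
      cfc (fun x : ℝ≥0 => x ^ (-(1 / 2) : ℝ) * x * x ^ (-(1 / 2) : ℝ)) M := by
    rw [cfc_mul _ _ M (hcont _) (hcont _), cfc_mul _ _ M (hcont _) (hcont _), cfc_id' ℝ≥0 M,
      CFC.rpow_def]
  rw [key]
  refine cfc_le_one _ M fun x _ => ?_
  rcases eq_or_ne x 0 with rfl | hx
  · simp
  · rw [mul_right_comm, ← NNReal.rpow_add hx, ← NNReal.rpow_add_one hx]
    norm_num

/-- The transpose of `(Yᵀ Y) ^ (-1/2) Yᵀ` does not increase the Euclidean norm. -/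
theorem Matrix.sum_sq_vecMul_rpow_neg_half_le {ι κ : Type*} [Fintype ι] [Fintype κ]
    [DecidableEq κ] (Y : Matrix ι κ ℝ) (h : κ → ℝ) :
    ∑ i, (h ᵥ* ((Yᵀ * Y) ^ (-(1 / 2) : ℝ) * Yᵀ)) i ^ 2 ≤ ∑ k, h k ^ 2 := by
  have hM : 0 ≤ Yᵀ * Y := by
    rw [Matrix.nonneg_iff_posSemidef]
    exact Matrix.posSemidef_conjTranspose_mul_self Y
  have hR : ((Yᵀ * Y) ^ (-(1 / 2) : ℝ))ᵀ = (Yᵀ * Y) ^ (-(1 / 2) : ℝ) :=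
    (Matrix.nonneg_iff_posSemidef.1
      (CFC.rpow_nonneg (a := Yᵀ * Y) (y := (-(1 / 2) : ℝ)))).isHermitian
  have hle := Matrix.le_iff.1 (Matrix.rpow_neg_half_conj_le_one hM)
  have hpos := hle.dotProduct_mulVec_nonneg h
  have e : ∑ i, (h ᵥ* ((Yᵀ * Y) ^ (-(1 / 2) : ℝ) * Yᵀ)) i ^ 2 =
      h ⬝ᵥ (((Yᵀ * Y) ^ (-(1 / 2) : ℝ) * (Yᵀ * Y) * (Yᵀ * Y) ^ (-(1 / 2) : ℝ)) *ᵥ h) := by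
    set R := (Yᵀ * Y) ^ (-(1 / 2) : ℝ)
    have : R * (Yᵀ * Y) * R = (R * Yᵀ) * (R * Yᵀ)ᵀ := by
      rw [Matrix.transpose_mul, Matrix.transpose_transpose, hR]
      simp only [Matrix.mul_assoc]
    rw [this, ← Matrix.mulVec_mulVec, Matrix.mulVec_transpose, Matrix.dotProduct_mulVec]
    simp only [dotProduct, sq]
  rw [Matrix.sub_mulVec, Matrix.one_mulVec, dotProduct_sub, star_trivial, ← e] at hpos
  have : h ⬝ᵥ h = ∑ k, h k ^ 2 := by simp only [dotProduct, sq]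
  linarith

theorem MeasureTheory.lintegral_ofReal_fintype_prod {ι : Type*} [Fintype ι] {E : Type*}
    [MeasurableSpace E] {μ : ι → Measure E} [∀ i, SigmaFinite (μ i)] {f : ι → E → ℝ}
    (hf : ∀ i, Integrable (f i) (μ i)) (h0 : ∀ i x, 0 ≤ f i x) :
    ∫⁻ x, ENNReal.ofReal (∏ i, f i (x i)) ∂Measure.pi μ =
      ENNReal.ofReal (∏ i, ∫ x, f i x ∂μ i) := by
  rw [← ofReal_integral_eq_lintegral_ofReal (Integrable.fintype_prod hf)
    (.of_forall fun x => Finset.prod_nonneg fun i _ => h0 i (x i)), integral_fintype_prod_eq_prod]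

theorem ProbabilityTheory.integral_exp_mul_gaussianReal (v : ℝ≥0) (t : ℝ) :
    ∫ x, Real.exp (t * x) ∂gaussianReal 0 v = Real.exp (v * t ^ 2 / 2) := by
  simpa [mgf] using mgf_gaussianReal (X := id) (p := gaussianReal 0 v) Measure.map_id t

theorem ProbabilityTheory.lintegral_exp_sum_mul_pi_gaussianReal {ι : Type*} [Fintype ι]
    (v : ι → ℝ≥0) (t : ι → ℝ) :
    ∫⁻ x, ENNReal.ofReal (Real.exp (∑ i, t i * x i)) ∂Measure.pi (fun i => gaussianReal 0 (v i)) =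
      ENNReal.ofReal (Real.exp (∑ i, v i * t i ^ 2 / 2)) := by
  simp_rw [Real.exp_sum]
  rw [lintegral_ofReal_fintype_prod (f := fun i x => Real.exp (t i * x))
    (fun i => integrable_exp_mul_gaussianReal _) (fun _ _ => (Real.exp_pos _).le)]
  simp_rw [integral_exp_mul_gaussianReal]

theorem ProbabilityTheory.gaussianPDFReal_mul_exp_sq (u x : ℝ) :
    gaussianPDFReal 0 1 x * Real.exp (u * x ^ 2) =
      (√(2 * Real.pi))⁻¹ * Real.exp (-((1 - 2 * u) / 2) * x ^ 2) := by
  rw [gaussianPDFReal, mul_assoc, ← Real.exp_add]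
  simp only [NNReal.coe_one, mul_one, sub_zero]
  congr 2
  ring

theorem ProbabilityTheory.integrable_exp_sq_gaussianReal {u : ℝ} (hu : 2 * u < 1) :
    Integrable (fun x => Real.exp (u * x ^ 2)) (gaussianReal 0 1) := by
  rw [gaussianReal_of_var_ne_zero 0 one_ne_zero,
    integrable_withDensity_iff_integrable_smul' (measurable_gaussianPDF 0 1)
      (.of_forall fun _ => gaussianPDF_lt_top)]
  simp only [toReal_gaussianPDF, smul_eq_mul, gaussianPDFReal_mul_exp_sq]
  exact (integrable_exp_neg_mul_sq (by linarith)).const_mul _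

theorem ProbabilityTheory.integral_exp_sq_gaussianReal (u : ℝ) :
    ∫ x, Real.exp (u * x ^ 2) ∂gaussianReal 0 1 = (√(1 - 2 * u))⁻¹ := by
  rw [integral_gaussianReal_eq_integral_smul one_ne_zero]
  simp only [smul_eq_mul, gaussianPDFReal_mul_exp_sq]
  rw [integral_const_mul, integral_gaussian, ← Real.sqrt_inv, ← Real.sqrt_inv,
    ← Real.sqrt_mul (by positivity)]
  congr 1
  have := Real.pi_pos.ne'
  rw [div_div_eq_mul_div, mul_comm Real.pi 2, ← mul_div_assoc, inv_mul_cancel₀ (by positivity),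
    one_div]

/-- The moment generating function of `‖A x‖²`, for a centred Gaussian vector `x` with independent
coordinates of variance at most `σ²`, and `A` with contractive transpose, is at most the one of
`σ²` times a chi-squared variable with as many degrees of freedom as `A` has rows. -/
theorem ProbabilityTheory.lintegral_exp_sum_sq_mulVec_le {ι κ : Type*} [Fintype ι] [Fintype κ]
    (A : Matrix κ ι ℝ) (hA : ∀ h : κ → ℝ, ∑ i, (h ᵥ* A) i ^ 2 ≤ ∑ k, h k ^ 2)
    (v : ι → ℝ≥0) {w : ℝ} (hw : 0 ≤ w) (hv : ∀ i, (v i : ℝ) ≤ w) {θ : ℝ} (hθ : 0 ≤ θ) (hθw : 2 * (θ * w) < 1) :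
    ∫⁻ x, ENNReal.ofReal (Real.exp (θ * ∑ k, (A *ᵥ x) k ^ 2))
        ∂Measure.pi (fun i => gaussianReal 0 (v i)) ≤
      ENNReal.ofReal ((√(1 - 2 * (θ * w)))⁻¹ ^ Fintype.card κ) := by
  -- Chosen so that `τ² / 2 = θ`, matching the Gaussian moment generating function `exp(t² / 2)`.
  set τ := √(2 * θ) with hτ
  have hτ2 : τ ^ 2 = 2 * θ := Real.sq_sqrt (by positivity)
  have hfst (x : ι → ℝ) : ENNReal.ofReal (Real.exp (θ * ∑ k, (A *ᵥ x) k ^ 2)) =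
      ∫⁻ h, ENNReal.ofReal (Real.exp (τ * (h ⬝ᵥ A *ᵥ x)))
        ∂Measure.pi (fun _ : κ => gaussianReal 0 1) := by
    have := lintegral_exp_sum_mul_pi_gaussianReal (fun _ : κ => 1) (fun k => τ * (A *ᵥ x) k)
    convert this.symm using 1
    · congr 2
      rw [Finset.mul_sum]
      refine Finset.sum_congr rfl fun k _ => ?_
      rw [mul_pow, hτ2]
      push_cast
      ring
    · refine lintegral_congr fun h => ?_
      simp only [dotProduct, Finset.mul_sum]
      congr 2
      exact Finset.sum_congr rfl fun k _ => by ring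
  have hsnd (h : κ → ℝ) : ∫⁻ x, ENNReal.ofReal (Real.exp (τ * (h ⬝ᵥ A *ᵥ x)))
      ∂Measure.pi (fun i => gaussianReal 0 (v i)) ≤
        ENNReal.ofReal (∏ k, Real.exp (θ * w * h k ^ 2)) := by
    have := lintegral_exp_sum_mul_pi_gaussianReal v (fun i => τ * (h ᵥ* A) i)
    simp_rw [Matrix.dotProduct_mulVec, dotProduct, Finset.mul_sum, ← mul_assoc]
    rw [this, ← Real.exp_sum]
    refine ENNReal.ofReal_le_ofReal (Real.exp_le_exp.2 ?_)
    rw [← Finset.mul_sum]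
    calc ∑ i, (v i : ℝ) * (τ * (h ᵥ* A) i) ^ 2 / 2
        ≤ ∑ i, θ * w * (h ᵥ* A) i ^ 2 := by
          refine Finset.sum_le_sum fun i _ => ?_
          rw [mul_pow, hτ2]
          nlinarith [mul_le_mul_of_nonneg_right (hv i) (mul_nonneg hθ (sq_nonneg ((h ᵥ* A) i)))]
      _ ≤ θ * w * ∑ k, h k ^ 2 := by
          rw [← Finset.mul_sum]
          exact mul_le_mul_of_nonneg_left (hA h) (mul_nonneg hθ hw)
  simp_rw [hfst]
  rw [lintegral_lintegral_swap (by fun_prop)]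
  refine (lintegral_mono hsnd).trans_eq ?_
  rw [lintegral_ofReal_fintype_prod (f := fun _ x => Real.exp (θ * w * x ^ 2))
    (fun _ => integrable_exp_sq_gaussianReal hθw) (fun _ _ => (Real.exp_pos _).le)]
  simp [integral_exp_sq_gaussianReal]

/-- As `a² = k`, the first exponent is `-c²/2 - ac`, while `(1 + c/a)^k < exp(c/a)^k = exp(ac)`.
This is the source of the strict inequality. -/
theorem Real.exp_mul_div_pow_lt {k : ℕ} (hk : k ≠ 0) {a c : ℝ} (ha : 0 < a) (hak : a ^ 2 = k)
    (hc : 0 < c) :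
    Real.exp (-(((a + c) ^ 2 - k) / 2)) * ((a + c) / a) ^ k < Real.exp (-(c ^ 2 / 2)) := by
  have hy : 0 < c / a := div_pos hc ha
  have h1 : ((a + c) / a) ^ k < Real.exp (a * c) := by
    have : Real.exp (a * c) = Real.exp (c / a) ^ k := by
      rw [← Real.exp_nat_mul, ← hak]
      congr 1
      field_simp
    rw [this]
    refine pow_lt_pow_left₀ ?_ (by positivity) hk
    rw [add_div, div_self ha.ne', add_comm]
    exact Real.add_one_lt_exp hy.ne'
  calc Real.exp (-(((a + c) ^ 2 - k) / 2)) * ((a + c) / a) ^ k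
      < Real.exp (-(((a + c) ^ 2 - k) / 2)) * Real.exp (a * c) := by gcongr
    _ = Real.exp (-(c ^ 2 / 2)) := by
      rw [← Real.exp_add, ← hak]
      congr 1
      ring

/-- Chi-squared type deviation bound for the Euclidean norm of a linear image of a Gaussian vector
with independent coordinates, under a matrix with contractive transpose. -/
theorem ProbabilityTheory.pi_gaussianReal_sqrt_sum_sq_mulVec_gt_lt {ι κ : Type*} [Fintype ι]
    [Fintype κ] [Nonempty κ] (A : Matrix κ ι ℝ)
    (hA : ∀ h : κ → ℝ, ∑ i, (h ᵥ* A) i ^ 2 ≤ ∑ k, h k ^ 2)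
    (s : ι → ℝ≥0) {σ : ℝ≥0} (hσ : 0 < σ) (hs : ∀ i, s i ≤ σ) {c : ℝ} (hc : 0 < c) :
    Measure.pi (fun i => gaussianReal 0 (s i ^ 2))
        {x | σ * (√(Fintype.card κ : ℝ) + c) < √(∑ k, (A *ᵥ x) k ^ 2)} <
      ENNReal.ofReal (Real.exp (-(c ^ 2 / 2))) := by
  have hk : Fintype.card κ ≠ 0 := Fintype.card_ne_zero
  set a := √(Fintype.card κ : ℝ) with ha_def
  have ha : 0 < a := Real.sqrt_pos.2 (by positivity)
  have hak : a ^ 2 = (Fintype.card κ : ℝ) := Real.sq_sqrt (by positivity)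
  have hσ' : (0 : ℝ) < σ := hσ
  have hr : 0 < a + c := by positivity
  -- `u = θσ²` at the Chernoff optimum: `exp(-u r²) (1 - 2u)^(-k/2)` with `r = a + c` is least when
  -- `1 - 2u = k / r²`.
  set u := (1 - (a / (a + c)) ^ 2) / 2 with hu
  have hq : 0 < a / (a + c) := by positivity
  have hq1 : a / (a + c) < 1 := (div_lt_one hr).2 (by linarith)
  have hu0 : 0 < u := by
    have : (a / (a + c)) ^ 2 < 1 := pow_lt_one₀ hq.le hq1 two_ne_zero
    rw [hu]
    linarith
  set θ := u / (σ : ℝ) ^ 2 with hθ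
  have hθ0 : 0 < θ := by positivity
  have hθσ : θ * (σ : ℝ) ^ 2 = u := div_mul_cancel₀ _ (by positivity)
  have hmgf := lintegral_exp_sum_sq_mulVec_le A hA (fun i => s i ^ 2) (w := (σ : ℝ) ^ 2)
    (by positivity) (fun i => by
      push_cast
      exact pow_le_pow_left₀ (s i).coe_nonneg (NNReal.coe_le_coe.2 (hs i)) 2) hθ0.le
    (by rw [hθσ, hu]; linarith [pow_pos hq 2])
  have hsqrt : (√(1 - 2 * (θ * (σ : ℝ) ^ 2)))⁻¹ = (a + c) / a := by
    rw [hθσ, hu, show 1 - 2 * ((1 - (a / (a + c)) ^ 2) / 2) = (a / (a + c)) ^ 2 by ring,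
      Real.sqrt_sq hq.le, inv_div]
  rw [hsqrt] at hmgf
  set B := Real.exp (((a + c) ^ 2 - (Fintype.card κ : ℝ)) / 2) with hB
  have hlevel : θ * (σ * (a + c)) ^ 2 = ((a + c) ^ 2 - (Fintype.card κ : ℝ)) / 2 := by
    rw [mul_pow, ← mul_assoc, hθσ, hu, ← hak]
    field_simp
  have hmarkov := mul_meas_ge_le_lintegral
    (μ := Measure.pi (fun i => gaussianReal 0 (s i ^ 2)))
    (f := fun x => ENNReal.ofReal (Real.exp (θ * ∑ k, (A *ᵥ x) k ^ 2)))
    (by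
      simp only [Matrix.mulVec, dotProduct]
      fun_prop) (ENNReal.ofReal B)
  have hsub : {x : ι → ℝ | σ * (a + c) < √(∑ k, (A *ᵥ x) k ^ 2)} ⊆
      {x | ENNReal.ofReal B ≤ ENNReal.ofReal (Real.exp (θ * ∑ k, (A *ᵥ x) k ^ 2))} := by
    intro x hx
    refine ENNReal.ofReal_le_ofReal (Real.exp_le_exp.2 ?_)
    rw [← hlevel]
    exact mul_le_mul_of_nonneg_left ((Real.lt_sqrt (by positivity)).1 hx).le hθ0.le
  have hBpos : 0 < B := Real.exp_pos _
  have hfinal : ((a + c) / a) ^ Fintype.card κ / B < Real.exp (-(c ^ 2 / 2)) := by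
    rw [div_eq_inv_mul, hB, ← Real.exp_neg]
    exact Real.exp_mul_div_pow_lt hk ha hak hc
  refine (measure_mono hsub).trans_lt (lt_of_le_of_lt ?_
    ((ENNReal.ofReal_lt_ofReal_iff (Real.exp_pos _)).2 hfinal))
  rw [ENNReal.ofReal_div_of_pos hBpos,
    ENNReal.le_div_iff_mul_le (.inl (by simpa using hBpos)) (.inl ENNReal.ofReal_ne_top), mul_comm]
  exact hmarkov.trans hmgf

theorem MeasureTheory.Measure.pi_dirac {ι : Type*} [Fintype ι] {E : ι → Type*}
    [∀ i, MeasurableSpace (E i)] (x : ∀ i, E i) :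
    Measure.pi (fun i => Measure.dirac (x i)) = Measure.dirac x := by
  classical
  refine Measure.pi_eq fun S hS => ?_
  rw [Measure.dirac_apply' _ (.univ_pi hS)]
  refine Eq.trans ?_ (Finset.prod_congr rfl fun i _ => (Measure.dirac_apply' _ (hS i)).symm)
  simp [Set.indicator_apply, Finset.prod_ite_zero]

theorem groupProjection_norm_eq {n p : ℕ} (X : Matrix (Fin n) (Fin p) ℝ) (F : Finset (Fin p))
    (v : Fin n → ℝ) :
    ‖groupProjection X F v‖ =
      √(∑ k, ((((colSubmatrix X F)ᵀ * colSubmatrix X F) ^ (-(1 / 2) : ℝ) *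
        (colSubmatrix X F)ᵀ) *ᵥ v) k ^ 2) := by
  simp [groupProjection, EuclideanSpace.norm_eq]

theorem measurable_groupProjection_norm {n p : ℕ} (X : Matrix (Fin n) (Fin p) ℝ)
    (F : Finset (Fin p)) : Measurable fun v => ‖groupProjection X F v‖ := by
  simp only [groupProjection_norm_eq, Matrix.mulVec, dotProduct]
  fun_prop

theorem proposition1 {Ω : Type*} [MeasurableSpace Ω] (μ : Measure Ω) [IsProbabilityMeasure μ]
    {n p m : ℕ} (X : Matrix (Fin n) (Fin p) ℝ) (G : Fin m → Finset (Fin p))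
    (hG : IsGroupPartition G) (ε : Fin n → Ω → ℝ) (s : Fin n → ℝ≥0) (σ : ℝ≥0)
    (hindep : iIndepFun ε μ)
    (hgauss : ∀ i, HasLaw (fun ω => ε i ω - ∫ ω', ε i ω' ∂μ) (gaussianReal 0 (s i ^ 2)) μ)
    (hs : ∀ i, s i ≤ σ) :
    GroupNoiseCondition μ X G ε (σ : ℝ) (√2 * (σ : ℝ)) := by
  refine ⟨σ.coe_nonneg, by positivity, fun j η hη0 hη1 => ?_⟩
  set Z : Ω → Fin n → ℝ := fun ω i => ε i ω - ∫ ω', ε i ω' ∂μ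
  set t := (σ : ℝ) * √((G j).card : ℝ) + √2 * (σ : ℝ) * √(-Real.log η) with ht
  have ht0 : 0 ≤ t := by positivity
  have hlog : 0 < -Real.log η := neg_pos.2 (Real.log_neg hη0 hη1)
  have hZ : AEMeasurable Z μ := aemeasurable_pi_lambda _ fun i => (hgauss i).aemeasurable
  have hlaw : μ.map Z = Measure.pi (fun i => gaussianReal 0 (s i ^ 2)) := by
    have h := (iIndepFun_iff_map_fun_eq_pi_map (fun i => (hgauss i).aemeasurable)).1
      (hindep.comp (fun i x => x - ∫ ω', ε i ω' ∂μ) fun i => by fun_prop)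
    simpa only [(hgauss _).map_eq] using h
  have hprob : IsProbabilityMeasure (μ.map Z) := Measure.isProbabilityMeasure_map hZ
  have hmeas : MeasurableSet {v : Fin n → ℝ | t < ‖groupProjection X (G j) v‖} :=
    measurableSet_lt measurable_const (measurable_groupProjection_norm X (G j))
  have hset : {ω | ‖groupProjection X (G j) (Z ω)‖ ≤ t} =
      Z ⁻¹' {v | t < ‖groupProjection X (G j) v‖}ᶜ := by
    ext ω
    simp
  suffices h : (μ.map Z).real {v | t < ‖groupProjection X (G j) v‖} < η by
    change 1 - η < μ.real {ω | ‖groupProjection X (G j) (Z ω)‖ ≤ t}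
    rw [hset, ← map_measureReal_apply_of_aemeasurable hZ hmeas.compl, probReal_compl_eq_one_sub hmeas]
    linarith
  -- The tail bound divides by `√k` and by `σ²`, so an empty group and `σ = 0` are treated apart; in
  -- both the norm vanishes almost surely.
  rcases (G j).eq_empty_or_nonempty with hemp | hne
  · have hempty : {v : Fin n → ℝ | t < ‖groupProjection X (G j) v‖} = ∅ := by
      have : IsEmpty (G j) := by simpa [hemp] using Finset.isEmpty_coe_sort.2 hemp
      ext v
      simpa [groupProjection_norm_eq] using ht0
    rw [hempty]
    simpa using hη0
  rcases eq_or_lt_of_le (zero_le (a := σ)) with hσ | hσ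
  · have hs0 (i : Fin n) : s i = 0 := le_antisymm (hσ ▸ hs i) zero_le
    have hdirac : μ.map Z = Measure.dirac 0 := by
      rw [hlaw, ← Measure.pi_dirac]
      congr 1
      ext1 i
      simp [hs0 i]
    rw [hdirac, measureReal_def, Measure.dirac_apply' _ hmeas]
    simpa [groupProjection_norm_eq, ht0] using hη0
  · have : Nonempty (G j) := hne.coe_sort
    have h := pi_gaussianReal_sqrt_sum_sq_mulVec_gt_lt _
      (Matrix.sum_sq_vecMul_rpow_neg_half_le (colSubmatrix X (G j))) s hσ hs
      (c := √2 * √(-Real.log η)) (by positivity)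
    have hc : Real.exp (-((√2 * √(-Real.log η)) ^ 2 / 2)) = η := by
      rw [mul_pow, Real.sq_sqrt zero_le_two, Real.sq_sqrt hlog.le, mul_div_cancel_left₀ _ two_ne_zero,
        neg_neg, Real.exp_log hη0]
    have ht' : t = σ * (√(Fintype.card (G j) : ℝ) + √2 * √(-Real.log η)) := by
      rw [ht, Fintype.card_coe]
      ring
    rw [hc, ← hlaw] at h
    simp_rw [← groupProjection_norm_eq, ← ht'] at h
    exact (ENNReal.lt_ofReal_iff_toReal_lt (measure_ne_top _ _)).1 h
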